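/- Let $n\ge 2$ and take the path graph with vertices $1,2,\dots,n$ (consecutive vertices being adjacent). To each vertex $k$ attach, by one of their ends, an arbitrary finite number of paths of length at most $f(k)$, where $$f(k)\le \frac1{20}\min\{k,\,n-k\};$$ here attaching a path of length $m$ to $k$ means adding $m$ new vertices $v_1,\dots,v_m$ and the $m$ edges $kv_1, v_1v_2,\dots,v_{m-1}v_m$, and different attached paths have no new vertices in common. Let $G$ be the resulting tree, let $L=D-A$ be its Laplacian matrix (degree matrix minus adjacency matrix), and let $\phi$ be a Fiedler vector of $G$, that is, any eigenvector of $L$ for its second smallest eigenvalue $\lambda_2(G)$, eigenvalues being counted with multiplicity. Then the global extrema of $\phi$ are attained at the endpoints of the longest path in $G$: the original path from $1$ to $n$ is a longest path of $G$, and for every longest path of $G$, $\phi$ attains its maximum over all vertices at one endpoint of that path and its minimum over all vertices at the other. -/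

import Mathlib

/-- The second smallest eigenvalue `λ₂` (counted with multiplicity) of the Laplacian matrix
`L = D - A` of a finite graph with at least two vertices. Mathlib's `eigenvalues₀` lists the
eigenvalues in decreasing order, so the last entry is `λ₁ = 0` and the one before it is `λ₂`. -/
noncomputable def lambdaTwo {V : Type*} [Fintype V] [DecidableEq V] (G : SimpleGraph V)
    [DecidableRel G.Adj] (h : 2 ≤ Fintype.card V) : ℝ :=
  (G.isHermitian_lapMatrix (R := ℝ)).eigenvalues₀ ⟨Fintype.card V - 2, by omega⟩

/-- `φ` is a Fiedler vector of `G`: a (nonzero) eigenvector of the Laplacian matrix for the second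
smallest eigenvalue. -/
def IsFiedlerVector {V : Type*} [Fintype V] [DecidableEq V] (G : SimpleGraph V)
    [DecidableRel G.Adj] (φ : V → ℝ) : Prop :=
  φ ≠ 0 ∧ ∃ h : 2 ≤ Fintype.card V, (G.lapMatrix ℝ).mulVec φ = lambdaTwo G h • φ

/-- `p` is a path (no repeated vertices) of maximal length among all paths of `G`. -/
def IsLongestPath {V : Type*} {G : SimpleGraph V} {u v : V} (p : G.Walk u v) : Prop :=
  p.IsPath ∧ ∀ (x y : V) (q : G.Walk x y), q.IsPath → q.length ≤ p.length

/-- Vertices of the path graph on `n` vertices with `c k` paths attached to its vertex `k`, the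
`i`-th of them of length `len k i`. `Sum.inl k` is a vertex of the main path, and
`Sum.inr ⟨⟨k, i⟩, j⟩` is the `j`-th new vertex (counted from `0`, starting next to the main path) of
the `i`-th path attached to `k`. A path of length `m` contributes `m` new vertices and `m` new
edges, the edge to the main path included. -/
abbrev AttachedPathsVertex (n : ℕ) (c : Fin n → ℕ) (len : (k : Fin n) → Fin (c k) → ℕ) : Type :=
  Fin n ⊕ (Σ p : (Σ k : Fin n, Fin (c k)), Fin (len p.1 p.2))

/-- The edges of the graph below, each one in the direction of increasing indices. -/
def attachedPathsRel (n : ℕ) (c : Fin n → ℕ) (len : (k : Fin n) → Fin (c k) → ℕ) :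
    AttachedPathsVertex n c len → AttachedPathsVertex n c len → Prop
  | Sum.inl a, Sum.inl b => a.val + 1 = b.val
  | Sum.inl a, Sum.inr v => v.1.1 = a ∧ v.2.val = 0
  | Sum.inr _, Sum.inl _ => False
  | Sum.inr v, Sum.inr w => v.1 = w.1 ∧ v.2.val + 1 = w.2.val

/-- The path graph on `n` vertices with `c k` paths, of lengths `len k i`, attached by one of their
ends to the vertex `k`. -/
def attachedPathsGraph (n : ℕ) (c : Fin n → ℕ) (len : (k : Fin n) → Fin (c k) → ℕ) :
    SimpleGraph (AttachedPathsVertex n c len) :=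
  SimpleGraph.fromRel (attachedPathsRel n c len)

/-! The tree is handled through its parent map towards the first vertex, so the Laplacian form is a
sum over `w` of the edges from `w` to its parent, and testing the eigenvalue equation with an
indicator says that the difference of `φ` across an edge is `λ₂` times the mass of `φ` beyond it.

Testing `λ₂` with the position along the main path gives `λ₂ * (n ^ 2 - 1) ≤ 12`. Attached paths are
so short on this scale that `φ` varies on each of them by less than its value at the foot; hence the
whole branch has the sign of its foot, and the signs of `φ` are known from the main path
(`IsWeakEigenvector.abs_sub_lt_or`).

A nodal domain argument shows that the sign changes once along the main path (`exists_sign_change`),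
and then the mass identity makes `φ` monotone there (`mainValue_antitone`). It remains to see that
no branch overtakes the ends. A branch of length `m` with positive foot is compared with the first
`m` edges of the main path. Both have a free end, but the main path carries additional positive mass
from its own branches, so by Sturm comparison it falls off faster from its free end; and by
monotonicity its value after `m` steps is at least that at the foot of the branch (`branch_le`). The
other end is symmetric, with `-φ`.

Longest paths are found by a separate count of distances (`isLongestPath_iff`). -/

/-! ### The variational principle for the second eigenvalue -/

open Matrix in
/-- Parseval's identity for the eigenvector basis of a real symmetric matrix. -/
theorem Matrix.IsHermitian.sum_dotProduct_mul_dotProduct {V : Type*} [Fintype V] [DecidableEq V]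
    {A : Matrix V V ℝ} (hA : A.IsHermitian) (x y : V → ℝ) :
    ∑ i, (x ⬝ᵥ ⇑(hA.eigenvectorBasis i)) * (⇑(hA.eigenvectorBasis i) ⬝ᵥ y) = x ⬝ᵥ y := by
  have h := hA.eigenvectorBasis.sum_inner_mul_inner (WithLp.toLp 2 x) (WithLp.toLp 2 y)
  simp only [EuclideanSpace.inner_eq_star_dotProduct, star_trivial] at h
  rw [dotProduct_comm x y, ← h]
  refine Finset.sum_congr rfl fun i _ => ?_
  rw [dotProduct_comm x, dotProduct_comm _ y]

open Matrix in
/-- A coordinate of `A x` in the eigenvector basis. -/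
theorem Matrix.IsHermitian.eigenvectorBasis_dotProduct_mulVec {V : Type*} [Fintype V]
    [DecidableEq V] {A : Matrix V V ℝ} (hA : A.IsHermitian) (x : V → ℝ) (i : V) :
    ⇑(hA.eigenvectorBasis i) ⬝ᵥ (A *ᵥ x) =
      hA.eigenvalues i * (⇑(hA.eigenvectorBasis i) ⬝ᵥ x) := by
  have hT : Aᵀ = A := by simpa [conjTranspose_eq_transpose_of_trivial] using hA.eq
  rw [dotProduct_mulVec, ← mulVec_transpose, hT, hA.mulVec_eigenvectorBasis, smul_dotProduct,
    smul_eq_mul]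

section LambdaTwo

open Matrix

variable {V : Type*} [Fintype V] [DecidableEq V] (G : SimpleGraph V) [DecidableRel G.Adj]

theorem lambdaTwo_nonneg (h : 2 ≤ Fintype.card V) : 0 ≤ lambdaTwo G h := by
  have h1 := (G.posSemidef_lapMatrix ℝ).eigenvalues_nonneg
    ((Fintype.equivOfCardEq (Fintype.card_fin _)) (⟨Fintype.card V - 2, by omega⟩ :
      Fin (Fintype.card V)))
  simpa [Matrix.IsHermitian.eigenvalues, lambdaTwo] using h1

theorem dotProduct_lapMatrix_mulVec_nonneg (ψ : V → ℝ) : 0 ≤ ψ ⬝ᵥ (G.lapMatrix ℝ *ᵥ ψ) := by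
  simpa using (G.posSemidef_lapMatrix ℝ).dotProduct_mulVec_nonneg ψ

/-- The variational characterization of `λ₂`. -/
theorem lambdaTwo_mul_le (h : 2 ≤ Fintype.card V) {ψ : V → ℝ} (hψ : ∑ v, ψ v = 0) :
    lambdaTwo G h * (ψ ⬝ᵥ ψ) ≤ ψ ⬝ᵥ (G.lapMatrix ℝ *ᵥ ψ) := by
  rcases (lambdaTwo_nonneg G h).eq_or_lt with h0 | hpos
  · rw [← h0, zero_mul]
    exact dotProduct_lapMatrix_mulVec_nonneg G ψ
  set hA := G.isHermitian_lapMatrix (R := ℝ)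
  set e : Fin (Fintype.card V) ≃ V := Fintype.equivOfCardEq (Fintype.card_fin _)
  set i₀ : V := e ⟨Fintype.card V - 1, by omega⟩ with hi₀
  have hμ : ∀ i, i ≠ i₀ → lambdaTwo G h ≤ hA.eigenvalues i := by
    intro i hi
    apply hA.eigenvalues₀_antitone
    rw [Fin.le_def]
    have h1 : e.symm i ≠ ⟨Fintype.card V - 1, by omega⟩ := by
      intro hc
      exact hi (by rw [hi₀, ← hc, Equiv.apply_symm_apply])
    have h2 : (e.symm i).val ≠ Fintype.card V - 1 := fun hc => h1 (Fin.ext hc)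
    have h3 := (e.symm i).isLt
    change (e.symm i).val ≤ Fintype.card V - 2
    omega
  -- Constants lie in the kernel, and `λ₂ > 0` makes every other eigenvalue nonzero. So constants
  -- are multiples of the eigenvector at `i₀`, and sum zero means orthogonality to it.
  have hone : ∀ i, i ≠ i₀ → (⇑(hA.eigenvectorBasis i) ⬝ᵥ fun _ => (1 : ℝ)) = 0 := by
    intro i hi
    have h1 := hA.eigenvectorBasis_dotProduct_mulVec (fun _ => (1 : ℝ)) i
    rw [G.lapMatrix_mulVec_const_eq_zero, dotProduct_zero] at h1
    exact (mul_eq_zero.mp h1.symm).resolve_left (hpos.trans_le (hμ i hi)).ne'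
  have hsum : ∀ x : V → ℝ, (x ⬝ᵥ ⇑(hA.eigenvectorBasis i₀)) *
      (⇑(hA.eigenvectorBasis i₀) ⬝ᵥ fun _ => (1 : ℝ)) = x ⬝ᵥ fun _ => (1 : ℝ) := by
    intro x
    rw [← hA.sum_dotProduct_mul_dotProduct x fun _ => 1, Finset.sum_eq_single i₀]
    · intro i _ hi
      rw [hone i hi, mul_zero]
    · simp
  have hne : (⇑(hA.eigenvectorBasis i₀) ⬝ᵥ fun _ => (1 : ℝ)) ≠ 0 := by
    intro hc
    have h1 := hsum fun _ => 1
    rw [hc, mul_zero] at h1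
    have h2 : ((fun _ => (1 : ℝ)) ⬝ᵥ fun _ : V => (1 : ℝ)) = Fintype.card V := by
      simp [dotProduct]
    have h3 : Fintype.card V = 0 := by exact_mod_cast (h1.trans h2).symm
    omega
  have hψ0 : ψ ⬝ᵥ ⇑(hA.eigenvectorBasis i₀) = 0 := by
    have h1 := hsum ψ
    have h2 : (ψ ⬝ᵥ fun _ => (1 : ℝ)) = 0 := by simpa [dotProduct] using hψ
    rw [h2] at h1
    exact (mul_eq_zero.mp h1).resolve_right hne
  rw [← hA.sum_dotProduct_mul_dotProduct ψ ψ, ← hA.sum_dotProduct_mul_dotProduct ψ,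
    Finset.mul_sum]
  refine Finset.sum_le_sum fun i _ => ?_
  rw [hA.eigenvectorBasis_dotProduct_mulVec, dotProduct_comm _ ψ]
  by_cases hi : i = i₀
  · rw [hi, hψ0]
    simp
  · nlinarith [mul_le_mul_of_nonneg_right (hμ i hi)
      (mul_self_nonneg (ψ ⬝ᵥ ⇑(hA.eigenvectorBasis i)))]

/-- The case of equality in the variational characterization of `λ₂`. -/
theorem lapMatrix_mulVec_eq_of_le (h : 2 ≤ Fintype.card V) {ψ : V → ℝ} (hψ : ∑ v, ψ v = 0)
    (hle : ψ ⬝ᵥ (G.lapMatrix ℝ *ᵥ ψ) ≤ lambdaTwo G h * (ψ ⬝ᵥ ψ)) :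
    G.lapMatrix ℝ *ᵥ ψ = lambdaTwo G h • ψ := by
  set L := G.lapMatrix ℝ
  set μ := lambdaTwo G h
  set η : V → ℝ := L *ᵥ ψ - μ • ψ with hη
  have hT : Lᵀ = L := G.isSymm_lapMatrix ℝ
  have hsymm : ∀ x y : V → ℝ, x ⬝ᵥ (L *ᵥ y) = y ⬝ᵥ (L *ᵥ x) := by
    intro x y
    rw [dotProduct_mulVec, ← mulVec_transpose, hT, dotProduct_comm]
  have hη0 : ∑ v, η v = 0 := by
    have h1 : (fun _ => (1 : ℝ)) ⬝ᵥ (L *ᵥ ψ) = 0 := by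
      rw [hsymm, G.lapMatrix_mulVec_const_eq_zero, dotProduct_zero]
    have h2 : ∑ v, (L *ᵥ ψ) v = 0 := by simpa [dotProduct] using h1
    simp [hη, Finset.sum_sub_distrib, h2, ← Finset.mul_sum, hψ]
  -- Perturbing `ψ` by its residual `η`: the constant term is at most 0 and the linear coefficient
  -- is `2 * (η ⬝ᵥ η)`, so a small negative `t` forces `η = 0`.
  have hq : ∀ t : ℝ, 0 ≤ (ψ ⬝ᵥ (L *ᵥ ψ) - μ * (ψ ⬝ᵥ ψ)) + 2 * t * (η ⬝ᵥ η) +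
      t ^ 2 * (η ⬝ᵥ (L *ᵥ η) - μ * (η ⬝ᵥ η)) := by
    intro t
    have h1 : ∑ v, (ψ + t • η) v = 0 := by
      simp [Finset.sum_add_distrib, ← Finset.mul_sum, hψ, hη0]
    have h2 : μ * ((ψ + t • η) ⬝ᵥ (ψ + t • η)) ≤ (ψ + t • η) ⬝ᵥ (L *ᵥ (ψ + t • η)) :=
      lambdaTwo_mul_le G h h1
    have h3 : η ⬝ᵥ η = η ⬝ᵥ (L *ᵥ ψ) - μ * (η ⬝ᵥ ψ) := by
      conv_lhs => rw [hη, dotProduct_sub, dotProduct_smul, smul_eq_mul, ← hη]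
    simp only [mulVec_add, mulVec_smul, dotProduct_add, add_dotProduct, smul_dotProduct,
      dotProduct_smul, smul_eq_mul] at h2
    rw [hsymm ψ η, dotProduct_comm ψ η] at h2
    linear_combination h2 - 2 * t * h3
  have hηη : 0 ≤ η ⬝ᵥ η := by simpa using dotProduct_star_self_nonneg η
  have hB : 0 ≤ η ⬝ᵥ (L *ᵥ η) - μ * (η ⬝ᵥ η) := sub_nonneg.mpr (lambdaTwo_mul_le G h hη0)
  set B := η ⬝ᵥ (L *ᵥ η) - μ * (η ⬝ᵥ η)
  have hz : η ⬝ᵥ η = 0 := by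
    by_contra hne
    have hp : 0 < η ⬝ᵥ η := lt_of_le_of_ne hηη (Ne.symm hne)
    -- Nearly the minimizer of the quadratic; `B + 1` replaces `B`, which may vanish.
    have h1 := hq (-(η ⬝ᵥ η) / (B + 1))
    set a := η ⬝ᵥ η
    have hB1 : 0 < B + 1 := by linarith
    have h2 : 2 * (-a / (B + 1)) * a + (-a / (B + 1)) ^ 2 * B =
        -(a ^ 2 * (B + 2)) / (B + 1) ^ 2 := by
      field_simp
      ring
    have h3 : -(a ^ 2 * (B + 2)) / (B + 1) ^ 2 < 0 :=
      div_neg_of_neg_of_pos (by nlinarith [mul_pos hp hp, pow_pos hp 2]) (by positivity)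
    linarith
  have := dotProduct_self_eq_zero.mp hz
  exact sub_eq_zero.mp this

end LambdaTwo

/-! ### The tree as a parent map, and its Laplacian form -/

namespace AttachedPaths

variable {n : ℕ} {c : Fin n → ℕ} {len : (k : Fin n) → Fin (c k) → ℕ}

/-- The next vertex on the way to the first vertex of the main path, which is its own parent. -/
def parent : AttachedPathsVertex n c len → AttachedPathsVertex n c len
  | Sum.inl k => Sum.inl ⟨k.val - 1, by omega⟩
  | Sum.inr ⟨p, j⟩ => if j.val = 0 then Sum.inl p.1 else Sum.inr ⟨p, ⟨j.val - 1, by omega⟩⟩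

/-- The index of the vertex of the main path to which the branch of a vertex is attached. -/
def foot : AttachedPathsVertex n c len → ℕ
  | Sum.inl k => k.val
  | Sum.inr v => v.1.1.val

/-- The distance of a vertex to the main path. -/
def depth : AttachedPathsVertex n c len → ℕ
  | Sum.inl _ => 0
  | Sum.inr v => v.2.val + 1

/-- `foot w + depth w` is the distance to the root and serves as the measure for inductions along
`parent`. -/
theorem foot_add_depth_parent (w : AttachedPathsVertex n c len) (hw : foot w + depth w ≠ 0) :
    foot (parent w) + depth (parent w) + 1 = foot w + depth w := by
  rcases w with k | ⟨p, j⟩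
  · simp only [foot, depth, parent] at *
    omega
  · by_cases hj : j.val = 0
    · simp [foot, depth, parent, hj]
    · simp [foot, depth, parent, hj]
      omega

theorem eq_of_foot_add_depth_eq_zero {w : AttachedPathsVertex n c len} (hn : 0 < n)
    (hw : foot w + depth w = 0) : w = Sum.inl ⟨0, hn⟩ := by
  rcases w with k | ⟨p, j⟩
  · simp only [foot, depth] at hw
    congr 1
    exact Fin.ext (by simpa using hw)
  · simp [foot, depth] at hw

theorem parent_eq_self_iff (w : AttachedPathsVertex n c len) :
    parent w = w ↔ foot w + depth w = 0 := by
  constructor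
  · intro h
    by_contra hw
    have := foot_add_depth_parent w hw
    rw [h] at this
    omega
  · intro h
    rcases w with k | ⟨p, j⟩
    · simp only [foot, depth, parent] at *
      congr 1
      exact Fin.ext (by simp; omega)
    · simp [foot, depth] at h

theorem rel_iff (v w : AttachedPathsVertex n c len) :
    attachedPathsRel n c len v w ↔ v ≠ w ∧ v = parent w := by
  rcases v with a | ⟨p, i⟩ <;> rcases w with b | ⟨q, j⟩
  · simp only [attachedPathsRel, parent, ne_eq, Sum.inl.injEq, Fin.ext_iff]
    omega
  · by_cases hj : j.val = 0
    · simp [attachedPathsRel, parent, hj, eq_comm]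
    · simp [attachedPathsRel, parent, hj]
  · simp [attachedPathsRel, parent]
  · by_cases hj : j.val = 0
    · simp [attachedPathsRel, parent, hj]
    · simp only [attachedPathsRel, parent, hj, if_false, ne_eq, Sum.inr.injEq]
      constructor
      · rintro ⟨h1, h2⟩
        subst h1
        simp only [Sigma.mk.injEq, heq_eq_eq, true_and, Fin.ext_iff]
        omega
      · rintro ⟨h1, h2⟩
        simp only [Sigma.mk.injEq] at h2
        obtain ⟨h2, h3⟩ := h2
        subst h2
        simp only [heq_eq_eq, Fin.ext_iff] at h3
        exact ⟨rfl, by omega⟩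

theorem adj_iff (v w : AttachedPathsVertex n c len) :
    (attachedPathsGraph n c len).Adj v w ↔ v ≠ w ∧ (v = parent w ∨ w = parent v) := by
  rw [attachedPathsGraph, SimpleGraph.fromRel_adj, rel_iff, rel_iff]
  tauto

theorem adj_parent {w : AttachedPathsVertex n c len} (h : parent w ≠ w) :
    (attachedPathsGraph n c len).Adj w (parent w) := by
  rw [adj_iff]
  exact ⟨h.symm, Or.inr rfl⟩

/-- A vertex and its parent are not each other's parents. -/
theorem parent_parent_ne {w : AttachedPathsVertex n c len} (h : parent w ≠ w) :
    parent (parent w) ≠ w := by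
  intro hc
  have h1 : foot w + depth w ≠ 0 := fun h0 => h ((parent_eq_self_iff w).mpr h0)
  have h2 := foot_add_depth_parent w h1
  by_cases h3 : foot (parent w) + depth (parent w) = 0
  · rw [(parent_eq_self_iff _).mpr h3] at hc
    exact h hc
  · have h4 := foot_add_depth_parent _ h3
    rw [hc] at h4
    omega

open Matrix in
/-- The bilinear form of the Laplacian as a sum over the edges of the tree. -/
theorem dotProduct_lapMatrix_mulVec [DecidableRel (attachedPathsGraph n c len).Adj]
    (φ ψ : AttachedPathsVertex n c len → ℝ) :
    ψ ⬝ᵥ ((attachedPathsGraph n c len).lapMatrix ℝ *ᵥ φ) =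
      ∑ w, (φ w - φ (parent w)) * (ψ w - ψ (parent w)) := by
  have h1 : ∀ v, ((attachedPathsGraph n c len).lapMatrix ℝ *ᵥ φ) v =
      ∑ w, ((if v = parent w then φ v - φ w else 0) +
        (if w = parent v then φ v - φ w else 0)) := by
    intro v
    rw [SimpleGraph.lapMatrix_mulVec_apply]
    have h2 : ((attachedPathsGraph n c len).degree v : ℝ) * φ v =
        ∑ w ∈ (attachedPathsGraph n c len).neighborFinset v, φ v := by
      simp
    rw [h2, ← Finset.sum_sub_distrib, SimpleGraph.neighborFinset_eq_filter, Finset.sum_filter]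
    refine Finset.sum_congr rfl fun w _ => ?_
    by_cases hvw : v = w
    · subst hvw
      simp
    · by_cases ha : v = parent w
      · have hb : w ≠ parent v := by
          rw [ha]
          exact (parent_parent_ne (ha ▸ hvw)).symm
        rw [if_pos ((adj_iff v w).mpr ⟨hvw, Or.inl ha⟩), if_pos ha, if_neg hb, add_zero]
      · by_cases hb : w = parent v
        · rw [if_pos ((adj_iff v w).mpr ⟨hvw, Or.inr hb⟩), if_neg ha, if_pos hb, zero_add]
        · rw [if_neg (fun h => ((adj_iff v w).mp h).2.elim ha hb), if_neg ha, if_neg hb, add_zero]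
  simp only [dotProduct, h1, Finset.sum_add_distrib, mul_add, Finset.mul_sum]
  -- Exchanging the sums in the first family indexes both halves of an edge by its child; the root,
  -- its own parent, contributes zero.
  rw [Finset.sum_comm, ← Finset.sum_add_distrib]
  refine Finset.sum_congr rfl fun w _ => ?_
  simp only [mul_ite, mul_zero, Finset.sum_ite_eq', Finset.mem_univ, if_true]
  ring

/-! ### Paths -/

theorem reachable_root (hn : 0 < n) (w : AttachedPathsVertex n c len) :
    (attachedPathsGraph n c len).Reachable w (Sum.inl ⟨0, hn⟩) := by
  induction h : foot w + depth w generalizing w with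
  | zero => rw [eq_of_foot_add_depth_eq_zero hn h]
  | succ m ih =>
    have h1 := foot_add_depth_parent w (by omega)
    have h2 : parent w ≠ w := fun hc => by
      rw [parent_eq_self_iff] at hc
      omega
    exact (adj_parent h2).reachable.trans (ih (parent w) (by omega))

theorem connected (hn : 0 < n) : (attachedPathsGraph n c len).Connected :=
  { preconnected := fun v w => (reachable_root hn v).trans (reachable_root hn w).symm
    nonempty := ⟨Sum.inl ⟨0, hn⟩⟩ }

theorem isTree (hn : 0 < n) : (attachedPathsGraph n c len).IsTree := by
  classical
  rw [SimpleGraph.isTree_iff_connected_and_card]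
  refine ⟨connected hn, le_antisymm ?_ (connected hn).card_vert_le_card_edgeSet_add_one⟩
  -- Every edge joins a vertex other than the root to its parent, so there are at most `|V| - 1`
  -- edges.
  have h1 : (attachedPathsGraph n c len).edgeSet ⊆
      (((Finset.univ.erase (Sum.inl ⟨0, hn⟩)).image fun w => s(w, parent w) :
        Finset (Sym2 (AttachedPathsVertex n c len))) : Set _) := by
    intro e
    induction e using Sym2.ind with
    | _ v w =>
      intro hvw
      rw [SimpleGraph.mem_edgeSet, adj_iff] at hvw
      have hroot : parent (Sum.inl ⟨0, hn⟩ : AttachedPathsVertex n c len) = Sum.inl ⟨0, hn⟩ :=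
        (parent_eq_self_iff _).mpr rfl
      simp only [Finset.coe_image, Set.mem_image, Finset.mem_coe, Finset.mem_erase,
        Finset.mem_univ, and_true]
      obtain ⟨hne, h | h⟩ := hvw
      · refine ⟨w, fun hc => hne ?_, ?_⟩
        · rw [h, hc, hroot]
        · rw [← h, Sym2.eq_swap]
      · refine ⟨v, fun hc => hne ?_, ?_⟩
        · rw [h, hc, hroot]
        · rw [← h]
  have h2 := Set.ncard_le_ncard h1 (Finset.finite_toSet _)
  rw [Set.ncard_coe_finset] at h2
  have h3 := h2.trans Finset.card_image_le
  rw [Finset.card_erase_of_mem (Finset.mem_univ _), Finset.card_univ] at h3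
  have h4 : 0 < Fintype.card (AttachedPathsVertex n c len) :=
    Fintype.card_pos_iff.mpr ⟨Sum.inl ⟨0, hn⟩⟩
  rw [Nat.card_coe_set_eq, Nat.card_eq_fintype_card]
  omega

theorem foot_parent_le (w : AttachedPathsVertex n c len) :
    foot (parent w) ≤ foot w ∧ foot w ≤ foot (parent w) + 1 := by
  rcases w with k | ⟨p, j⟩
  · simp only [foot, parent]
    omega
  · by_cases hj : j.val = 0 <;> simp [foot, parent, hj]

theorem foot_le_foot_add_length {v w : AttachedPathsVertex n c len}
    (p : (attachedPathsGraph n c len).Walk v w) : foot w ≤ foot v + p.length := by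
  induction p with
  | nil => simp
  | @cons u v w h p ih =>
    rw [adj_iff] at h
    rw [SimpleGraph.Walk.length_cons]
    have h1 := foot_parent_le u
    have h2 := foot_parent_le v
    obtain ⟨-, h | h⟩ := h
    · rw [← h] at h2
      omega
    · rw [← h] at h1
      omega

theorem foot_lt (w : AttachedPathsVertex n c len) : foot w < n := by
  rcases w with k | v
  · exact k.isLt
  · exact v.1.1.isLt

/-- The vertex of the main path to which the branch of a vertex is attached. -/
def base (w : AttachedPathsVertex n c len) : AttachedPathsVertex n c len :=
  Sum.inl ⟨foot w, foot_lt w⟩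

theorem dist_base_le (w : AttachedPathsVertex n c len) :
    (attachedPathsGraph n c len).dist w (base w) ≤ depth w := by
  have hn : 0 < n := (Nat.zero_le _).trans_lt (foot_lt w)
  induction h : depth w generalizing w with
  | zero =>
    rcases w with k | v
    · simp [base, foot]
    · simp [depth] at h
  | succ m ih =>
    rcases w with k | ⟨p, j⟩
    · simp [depth] at h
    have h0 : parent (Sum.inr ⟨p, j⟩ : AttachedPathsVertex n c len) ≠ Sum.inr ⟨p, j⟩ := by
      rw [Ne, parent_eq_self_iff]
      omega
    have h1 : base (parent (Sum.inr ⟨p, j⟩ : AttachedPathsVertex n c len)) =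
        base (Sum.inr ⟨p, j⟩) := by
      by_cases hj : j.val = 0 <;> simp [base, foot, parent, hj]
    have h2 : depth (parent (Sum.inr ⟨p, j⟩ : AttachedPathsVertex n c len)) = m := by
      simp only [depth] at h
      by_cases hj : j.val = 0
      · simp [depth, parent, hj]
        omega
      · simp [depth, parent, hj]
        omega
    have h3 := ih (parent (Sum.inr ⟨p, j⟩)) h2
    rw [h1] at h3
    have h4 := (connected (c := c) (len := len) hn).dist_triangle (u := Sum.inr ⟨p, j⟩)
      (v := parent (Sum.inr ⟨p, j⟩)) (w := base (Sum.inr ⟨p, j⟩))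
    rw [SimpleGraph.dist_eq_one_iff_adj.mpr (adj_parent h0)] at h4
    omega

theorem dist_inl_le (i d : ℕ) (h : i + d < n) :
    (attachedPathsGraph n c len).dist (Sum.inl ⟨i + d, h⟩) (Sum.inl ⟨i, by omega⟩) ≤ d := by
  induction d with
  | zero => simp
  | succ d ih =>
    have h1 : (attachedPathsGraph n c len).Adj (Sum.inl ⟨i + (d + 1), h⟩)
        (Sum.inl ⟨i + d, by omega⟩) := by
      rw [adj_iff]
      simp [parent]
    have h4 := (connected (c := c) (len := len) (by omega)).dist_triangle
      (u := Sum.inl ⟨i + (d + 1), h⟩) (v := Sum.inl ⟨i + d, by omega⟩) (w := Sum.inl ⟨i, by omega⟩)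
    rw [SimpleGraph.dist_eq_one_iff_adj.mpr h1] at h4
    have := ih (by omega)
    omega

/-- The route goes through the two feet. Only this upper bound is needed; lengths are bounded below
by `foot_le_foot_add_length`. -/
theorem dist_le {v w : AttachedPathsVertex n c len} (h : foot w ≤ foot v) :
    (attachedPathsGraph n c len).dist v w ≤ depth v + (foot v - foot w) + depth w := by
  have hc := connected (c := c) (len := len) ((Nat.zero_le _).trans_lt (foot_lt w))
  have h1 := hc.dist_triangle (u := v) (v := base v) (w := w)
  have h2 := hc.dist_triangle (u := base v) (v := base w) (w := w)
  have h3 := dist_base_le v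
  have h4 := dist_base_le w
  rw [SimpleGraph.dist_comm] at h4
  have h5 := dist_inl_le (c := c) (len := len) (foot w) (foot v - foot w)
    (by have := foot_lt v; omega)
  have h6 : (⟨foot w + (foot v - foot w), by have := foot_lt v; omega⟩ : Fin n) =
      ⟨foot v, foot_lt v⟩ := Fin.ext (by simp only; omega)
  rw [h6] at h5
  change (attachedPathsGraph n c len).dist (base v) (base w) ≤ _ at h5
  omega

theorem length_eq_dist {v w : AttachedPathsVertex n c len}
    {p : (attachedPathsGraph n c len).Walk v w} (hp : p.IsPath) :
    p.length = (attachedPathsGraph n c len).dist v w := by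
  have hn : 0 < n := (Nat.zero_le _).trans_lt (foot_lt w)
  obtain ⟨q, hq, hl⟩ := (connected (c := c) (len := len) hn).exists_path_of_dist v w
  have := ((isTree (c := c) (len := len) hn).isAcyclic.subsingleton_path v w).elim ⟨p, hp⟩ ⟨q, hq⟩
  rw [← hl]
  simpa using congrArg (fun r => r.1.length) this

/-- If the attached paths are short, the only vertices at distance at least `n - 1` are the ends of
the main path. -/
theorem eq_ends_of_le_dist (hn : 0 < n)
    (hd : ∀ w : AttachedPathsVertex n c len, depth w ≠ 0 →
      depth w < foot w ∧ depth w + foot w + 1 < n)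
    {v w : AttachedPathsVertex n c len} (hvw : foot w ≤ foot v) :
    (attachedPathsGraph n c len).dist v w ≤ n - 1 ∧
      (n - 1 ≤ (attachedPathsGraph n c len).dist v w →
        v = Sum.inl ⟨n - 1, by omega⟩ ∧ w = Sum.inl ⟨0, hn⟩) := by
  have h1 := dist_le hvw
  have h2 := foot_lt v
  have h3 := hd v
  have h4 := hd w
  -- A branch vertex lies strictly closer to its foot than the foot does to either end of the main
  -- path, so a positive depth on either side keeps the distance below `n - 1`.
  refine ⟨by omega, fun h => ⟨?_, eq_of_foot_add_depth_eq_zero hn (by omega)⟩⟩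
  have h5 : depth v = 0 := by omega
  have h6 : foot v = n - 1 := by omega
  rcases v with k | v
  · congr 1
    exact Fin.ext h6
  · simp [depth] at h5

/-- If the attached paths are short, the longest paths are those between the ends of the main
path. -/
theorem isLongestPath_iff (hn : 0 < n)
    (hd : ∀ w : AttachedPathsVertex n c len, depth w ≠ 0 →
      depth w < foot w ∧ depth w + foot w + 1 < n) :
    (∃ p : (attachedPathsGraph n c len).Walk (Sum.inl ⟨0, hn⟩) (Sum.inl ⟨n - 1, by omega⟩),
      IsLongestPath p) ∧
    ∀ (u v : AttachedPathsVertex n c len) (p : (attachedPathsGraph n c len).Walk u v),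
      IsLongestPath p →
      (u = Sum.inl ⟨0, hn⟩ ∧ v = Sum.inl ⟨n - 1, by omega⟩) ∨
      (v = Sum.inl ⟨0, hn⟩ ∧ u = Sum.inl ⟨n - 1, by omega⟩) := by
  obtain ⟨p, hp, -⟩ := (connected (c := c) (len := len) hn).exists_path_of_dist
    (Sum.inl ⟨0, hn⟩) (Sum.inl ⟨n - 1, by omega⟩)
  have hlen : n - 1 ≤ p.length := by
    have := foot_le_foot_add_length p
    simpa [foot] using this
  refine ⟨⟨p, hp, fun x y q hq => ?_⟩, fun u v q hq => ?_⟩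
  · rw [length_eq_dist hq]
    rcases le_total (foot y) (foot x) with h | h
    · exact (eq_ends_of_le_dist hn hd h).1.trans hlen
    · rw [SimpleGraph.dist_comm]
      exact (eq_ends_of_le_dist hn hd h).1.trans hlen
  · have h1 := hlen.trans (hq.2 _ _ p hp)
    rw [length_eq_dist hq.1] at h1
    rcases le_total (foot v) (foot u) with h | h
    · exact Or.inr ((eq_ends_of_le_dist hn hd h).2 h1).symm
    · rw [SimpleGraph.dist_comm] at h1
      exact Or.inl ((eq_ends_of_le_dist hn hd h).2 h1).symm

end AttachedPaths

namespace AttachedPaths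

/-! ### Sequences -/

/-- A solution of the eigenvalue equation for a small eigenvalue along a short path with a free
end varies by less than its value at the other end. -/
theorem abs_sub_lt_or_eq_zero {μ : ℝ} (hμ : 0 ≤ μ) {m : ℕ} (hm : μ * (m : ℝ) ^ 2 < 1 / 2)
    {z : ℕ → ℝ}
    (hz : ∀ j < m, z (j + 1) - z j = μ * ∑ i ∈ Finset.range m, if j ≤ i then z (i + 1) else 0)
    {i : ℕ} (hi : i ≤ m) : |z i - z 0| < |z 0| ∨ z 0 = 0 ∧ z i = 0 := by
  -- With `M` the maximum of `|z|`, each step is at most `μ * m * M`, so the total drift is at most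
  -- `μ * m ^ 2 * M`, below `M / 2` if `M > 0`. Applied at `J` this gives `|z 0| > M / 2`, which
  -- exceeds the drift everywhere.
  obtain ⟨J, hJ, hmax⟩ := Finset.exists_max_image (Finset.range (m + 1)) (fun i => |z i|) ⟨0, by simp⟩
  set M := |z J|
  have hM : 0 ≤ M := abs_nonneg _
  have hle : ∀ i ≤ m, |z i| ≤ M := fun i hi => hmax i (Finset.mem_range.mpr (by omega))
  have hstep : ∀ j < m, |z (j + 1) - z j| ≤ μ * (m * M) := by
    intro j hj
    rw [hz j hj, abs_mul, abs_of_nonneg hμ]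
    refine mul_le_mul_of_nonneg_left ?_ hμ
    refine (Finset.abs_sum_le_sum_abs _ _).trans ?_
    have : ∑ i ∈ Finset.range m, |if j ≤ i then z (i + 1) else 0| ≤
        ∑ i ∈ Finset.range m, M := by
      refine Finset.sum_le_sum fun i hi => ?_
      rw [Finset.mem_range] at hi
      split_ifs
      · exact hle _ (by omega)
      · simpa using hM
    simpa using this
  have hdiff : ∀ i ≤ m, |z i - z 0| ≤ i * (μ * (m * M)) := by
    intro i
    induction i with
    | zero => simp
    | succ j ih =>
      intro hj
      have h1 := ih (by omega)
      have h2 := hstep j (by omega)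
      have h3 := abs_sub_le (z (j + 1)) (z j) (z 0)
      push_cast
      linarith
  have hdiff' : ∀ i ≤ m, |z i - z 0| ≤ μ * (m : ℝ) ^ 2 * M := by
    intro i hi
    refine (hdiff i hi).trans ?_
    have h1 : (i : ℝ) ≤ m := by exact_mod_cast hi
    have h2 : 0 ≤ μ * (m * M) := by positivity
    nlinarith [mul_le_mul_of_nonneg_right h1 h2]
  have hJm : J ≤ m := by
    have := Finset.mem_range.mp hJ
    omega
  have h1 := hdiff' J hJm
  have h2 : M ≤ |z J - z 0| + |z 0| := by
    have := abs_add_le (z J - z 0) (z 0)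
    simpa using this
  rcases hM.eq_or_lt with h0 | hpos
  · right
    constructor
    · have := hle 0 (by omega)
      exact abs_nonpos_iff.mp (by linarith)
    · have := hle i hi
      exact abs_nonpos_iff.mp (by linarith)
  · left
    have h3 := hdiff' i hi
    have h4 : μ * (m : ℝ) ^ 2 * M < 1 / 2 * M := mul_lt_mul_of_pos_right hm hpos
    linarith

/-- A discrete Sturm comparison theorem. -/
theorem sturm_comparison {μ : ℝ} {m : ℕ} {u v : ℕ → ℝ}
    (hv : ∀ i ≤ m, 0 < v i) (hu₀ : 1 ≤ m → u 1 - u 0 ≤ -(μ * u 0))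
    (hu₁ : ∀ j, j + 2 ≤ m → u (j + 2) - 2 * u (j + 1) + u j ≤ -(μ * u (j + 1)))
    (hv₀ : 1 ≤ m → v 1 - v 0 = -(μ * v 0))
    (hv₁ : ∀ j, j + 2 ≤ m → v (j + 2) - 2 * v (j + 1) + v j = -(μ * v (j + 1))) :
    u m * v 0 ≤ u 0 * v m := by
  -- The discrete Wronskian `u (j + 1) * v j - u j * v (j + 1)` starts nonpositive and does not
  -- increase, so `u / v` is nonincreasing.
  have h1 : ∀ j, j + 1 ≤ m → u (j + 1) * v j ≤ u j * v (j + 1) := by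
    intro j
    induction j with
    | zero =>
      intro hj
      have h2 : v 1 = v 0 - μ * v 0 := by linarith [hv₀ hj]
      have h3 : u 1 ≤ u 0 - μ * u 0 := by linarith [hu₀ hj]
      have h4 := mul_le_mul_of_nonneg_right h3 (hv 0 (by omega)).le
      rw [zero_add, h2]
      linarith
    | succ j ih =>
      intro hj
      have h2 : v (j + 2) = 2 * v (j + 1) - v j - μ * v (j + 1) := by linarith [hv₁ j (by omega)]
      have h3 : u (j + 2) ≤ 2 * u (j + 1) - u j - μ * u (j + 1) := by linarith [hu₁ j (by omega)]
      have h4 := mul_le_mul_of_nonneg_right h3 (hv (j + 1) (by omega)).le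
      have h5 := ih (by omega)
      change u (j + 2) * v (j + 1) ≤ u (j + 1) * v (j + 2)
      rw [h2]
      linarith
  have h2 : ∀ j, j ≤ m → u j * v 0 ≤ u 0 * v j := by
    intro j
    induction j with
    | zero => intro _; exact le_rfl
    | succ j ih =>
      intro hj
      have h3 := mul_le_mul_of_nonneg_right (h1 j hj) (hv 0 (by omega)).le
      have h4 := mul_le_mul_of_nonneg_right (ih (by omega)) (hv (j + 1) hj).le
      refine le_of_mul_le_mul_right ?_ (hv j (by omega))
      linarith
  exact h2 m le_rfl

/-- Comparison of a branch `z` with a piece `u` of the main path that carries more mass. -/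
theorem branch_le {μ : ℝ} (hμ : 0 ≤ μ) {m : ℕ} {u z : ℕ → ℝ}
    (hu : ∀ i ≤ m, 0 < u i) (hzpos : ∀ i ≤ m, 0 < z i)
    (hu₀ : 1 ≤ m → u 1 - u 0 ≤ -(μ * u 0))
    (hu₁ : ∀ j, j + 2 ≤ m → u (j + 2) - 2 * u (j + 1) + u j ≤ -(μ * u (j + 1)))
    (hz : ∀ j < m, z (j + 1) - z j = μ * ∑ i ∈ Finset.range m, if j ≤ i then z (i + 1) else 0)
    (h0 : z 0 ≤ u m) {i : ℕ} (hi : i ≤ m) : z i ≤ u 0 := by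
  have hsum : ∀ j < m, (∑ i ∈ Finset.range m, if j ≤ i then z (i + 1) else 0) =
      z (j + 1) + ∑ i ∈ Finset.range m, if j + 1 ≤ i then z (i + 1) else 0 := by
    intro j hj
    rw [← Finset.add_sum_erase _ _ (Finset.mem_range.mpr hj),
      ← Finset.add_sum_erase _ (fun i => if j + 1 ≤ i then z (i + 1) else 0)
        (Finset.mem_range.mpr hj)]
    simp only [le_refl, if_true, Nat.not_succ_le_self, if_false, zero_add]
    congr 1
    refine Finset.sum_congr rfl fun i hi => ?_
    have h1 := (Finset.mem_erase.mp hi).1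
    have h2 : j ≤ i ↔ j + 1 ≤ i := by omega
    simp only [h2]
  have hlast : (∑ i ∈ Finset.range m, if m ≤ i then z (i + 1) else 0) = 0 := by
    refine Finset.sum_eq_zero fun i hi => ?_
    rw [Finset.mem_range] at hi
    rw [if_neg (by omega)]
  have hmono : ∀ d, d ≤ m → z (m - d) ≤ z m := by
    intro d
    induction d with
    | zero => intro _; exact le_rfl
    | succ d ih =>
      intro hd
      have h1 := hz (m - (d + 1)) (by omega)
      have h2 : m - (d + 1) + 1 = m - d := by omega
      rw [h2] at h1
      have h3 : 0 ≤ ∑ i ∈ Finset.range m, if m - (d + 1) ≤ i then z (i + 1) else 0 := by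
        refine Finset.sum_nonneg fun i hi => ?_
        rw [Finset.mem_range] at hi
        split_ifs
        · exact (hzpos _ (by omega)).le
        · exact le_rfl
      have h4 := mul_nonneg hμ h3
      linarith [ih (by omega)]
  -- The branch is reversed so that both sequences start at a free end. The result is `u m * z m ≤ u
  -- 0 * z 0`, and `z 0 ≤ u m` then gives `z m ≤ u 0`.
  have hcomp := sturm_comparison (μ := μ) (m := m) (u := u) (v := fun j => z (m - j))
    (fun i _ => hzpos _ (by omega)) hu₀ hu₁
    (fun h => by
      have h1 := hz (m - 1) (by omega)
      rw [hsum (m - 1) (by omega)] at h1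
      have h2 : m - 1 + 1 = m := by omega
      rw [h2, hlast] at h1
      simp only [Nat.sub_zero]
      linarith)
    (fun j hj => by
      obtain ⟨i, rfl⟩ : ∃ i, m = i + (j + 2) := ⟨m - (j + 2), by omega⟩
      have e0 : i + (j + 2) - (j + 2) = i := by omega
      have e1 : i + (j + 2) - (j + 1) = i + 1 := by omega
      have e2 : i + (j + 2) - j = i + 2 := by omega
      simp only [e0, e1, e2]
      have h1 := hz i (by omega)
      have h2 := hz (i + 1) (by omega)
      rw [hsum i (by omega)] at h1
      linarith)
  simp only [Nat.sub_zero, Nat.sub_self] at hcomp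
  have h1 : z i ≤ z m := by
    have := hmono (m - i) (by omega)
    rwa [Nat.sub_sub_self hi] at this
  refine h1.trans (le_of_mul_le_mul_left ?_ (hu m le_rfl))
  have h2 := mul_le_mul_of_nonneg_left h0 (hu 0 (by omega)).le
  linarith

/-! ### Eigenvectors -/

variable {n : ℕ} {c : Fin n → ℕ} {len : (k : Fin n) → Fin (c k) → ℕ}

/-- The weak form of the eigenvalue equation `L φ = μ φ`. -/
def IsWeakEigenvector (μ : ℝ) (φ : AttachedPathsVertex n c len → ℝ) : Prop :=
  ∀ ψ : AttachedPathsVertex n c len → ℝ,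
    ∑ w, (φ w - φ (parent w)) * (ψ w - ψ (parent w)) = μ * ∑ w, φ w * ψ w

open Matrix in
theorem IsWeakEigenvector.of_mulVec [DecidableRel (attachedPathsGraph n c len).Adj] {μ : ℝ}
    {φ : AttachedPathsVertex n c len → ℝ}
    (h : (attachedPathsGraph n c len).lapMatrix ℝ *ᵥ φ = μ • φ) : IsWeakEigenvector μ φ := by
  intro ψ
  rw [← dotProduct_lapMatrix_mulVec, h, dotProduct_smul, dotProduct_comm, smul_eq_mul]
  rfl

theorem IsWeakEigenvector.add {μ : ℝ} {φ ψ : AttachedPathsVertex n c len → ℝ}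
    (hφ : IsWeakEigenvector μ φ) (hψ : IsWeakEigenvector μ ψ) : IsWeakEigenvector μ (φ + ψ) := by
  intro η
  have h1 := hφ η
  have h2 := hψ η
  simp only [Pi.add_apply, add_mul, Finset.sum_add_distrib, mul_add]
  rw [← h1, ← h2, ← Finset.sum_add_distrib]
  exact Finset.sum_congr rfl fun w _ => by ring

theorem IsWeakEigenvector.smul {μ : ℝ} {φ : AttachedPathsVertex n c len → ℝ}
    (hφ : IsWeakEigenvector μ φ) (t : ℝ) : IsWeakEigenvector μ (t • φ) := by
  intro η
  have h1 := hφ η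
  simp only [Pi.smul_apply, smul_eq_mul, mul_assoc, ← mul_sub, ← Finset.mul_sum]
  rw [h1]
  ring

theorem IsWeakEigenvector.neg {μ : ℝ} {φ : AttachedPathsVertex n c len → ℝ}
    (hφ : IsWeakEigenvector μ φ) : IsWeakEigenvector μ (-φ) := by
  simpa using hφ.smul (-1)

theorem IsWeakEigenvector.sum_eq_zero {μ : ℝ} {φ : AttachedPathsVertex n c len → ℝ}
    (hφ : IsWeakEigenvector μ φ) (hμ : μ ≠ 0) : ∑ w, φ w = 0 := by
  have h := hφ fun _ => 1
  simp only [sub_self, mul_zero, Finset.sum_const_zero, mul_one] at h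
  exact (mul_eq_zero.mp h.symm).resolve_left hμ

theorem IsWeakEigenvector.eq_of_zero {φ : AttachedPathsVertex n c len → ℝ}
    (hφ : IsWeakEigenvector 0 φ) (v w : AttachedPathsVertex n c len) : φ v = φ w := by
  have h := hφ φ
  rw [zero_mul, Finset.sum_eq_zero_iff_of_nonneg fun w _ => mul_self_nonneg _] at h
  have h1 : ∀ w, φ w = φ (parent w) := fun w =>
    sub_eq_zero.mp (mul_self_eq_zero.mp (h w (Finset.mem_univ w)))
  have hn : 0 < n := (Nat.zero_le _).trans_lt (foot_lt w)
  have h2 : ∀ w : AttachedPathsVertex n c len, φ w = φ (Sum.inl ⟨0, hn⟩) := by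
    intro w
    induction hm : foot w + depth w generalizing w with
    | zero => rw [eq_of_foot_add_depth_eq_zero hn hm]
    | succ m ih =>
      have h3 := foot_add_depth_parent w (by omega)
      rw [h1, ih (parent w) (by omega)]
  rw [h2 v, h2 w]

/-- The values of `φ` along the main path. -/
noncomputable def mainValue (φ : AttachedPathsVertex n c len → ℝ) (k : ℕ) : ℝ :=
  if h : k < n then φ (Sum.inl ⟨k, h⟩) else 0

/-- The values of `φ` along an attached path, starting with the one on the main path. -/
noncomputable def branchValue (φ : AttachedPathsVertex n c len → ℝ)
    (p : Σ k : Fin n, Fin (c k)) : ℕ → ℝ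
  | 0 => φ (Sum.inl p.1)
  | j + 1 => if h : j < len p.1 p.2 then φ (Sum.inr ⟨p, ⟨j, h⟩⟩) else 0

/-- The sum of `φ` over the vertices whose branch is attached at `k` or later. -/
noncomputable def tailSum (φ : AttachedPathsVertex n c len → ℝ) (k : ℕ) : ℝ :=
  ∑ w, if k ≤ foot w then φ w else 0

/-- The sum of `φ` over the vertices whose branch is attached before `k`. -/
noncomputable def headSum (φ : AttachedPathsVertex n c len → ℝ) (k : ℕ) : ℝ :=
  ∑ w, if foot w < k then φ w else 0

theorem mainValue_inl (φ : AttachedPathsVertex n c len → ℝ) (k : Fin n) :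
    mainValue φ k = φ (Sum.inl k) := by
  simp [mainValue]

theorem mainValue_of_lt (φ : AttachedPathsVertex n c len → ℝ) {k : ℕ} (h : k < n) :
    mainValue φ k = φ (Sum.inl ⟨k, h⟩) := by
  simp [mainValue, h]

theorem mainValue_neg (φ : AttachedPathsVertex n c len → ℝ) (k : ℕ) :
    mainValue (-φ) k = -mainValue φ k := by
  unfold mainValue
  split_ifs <;> simp

theorem branchValue_succ (φ : AttachedPathsVertex n c len → ℝ) (p : Σ k : Fin n, Fin (c k))
    (j : Fin (len p.1 p.2)) : branchValue φ p (j + 1) = φ (Sum.inr ⟨p, j⟩) := by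
  simp [branchValue]

theorem headSum_add_tailSum (φ : AttachedPathsVertex n c len → ℝ) (k : ℕ) :
    headSum φ k + tailSum φ k = ∑ w, φ w := by
  rw [headSum, tailSum, ← Finset.sum_add_distrib]
  refine Finset.sum_congr rfl fun w _ => ?_
  by_cases h : foot w < k
  · rw [if_pos h, if_neg (by omega), add_zero]
  · rw [if_neg h, if_pos (by omega), zero_add]

/-- The test function is the indicator of everything attached at `k + 1` or later; the only edge
leaving that set is the one between `k` and `k + 1`. -/
theorem IsWeakEigenvector.mainValue_sub {μ : ℝ} {φ : AttachedPathsVertex n c len → ℝ}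
    (hφ : IsWeakEigenvector μ φ) {k : ℕ} (hk : k + 1 < n) :
    mainValue φ (k + 1) - mainValue φ k = μ * tailSum φ (k + 1) := by
  have h := hφ fun w => if k + 1 ≤ foot w then 1 else 0
  simp only [mul_ite, mul_one, mul_zero] at h
  rw [tailSum, ← h, Finset.sum_eq_single (Sum.inl ⟨k + 1, hk⟩)]
  · rw [mainValue_of_lt φ hk, mainValue_of_lt φ (by omega : k < n)]
    simp [parent, foot]
  · intro w _ hw
    have : k + 1 ≤ foot w ↔ k + 1 ≤ foot (parent w) := by
      rcases w with i | ⟨p, j⟩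
      · have h1 : i.val ≠ k + 1 := fun h1 => hw (by congr 1; exact Fin.ext h1)
        simp only [foot, parent]
        omega
      · by_cases hj : j.val = 0 <;> simp [foot, parent, hj]
    simp only [this, sub_self, mul_zero]
  · simp

theorem IsWeakEigenvector.mainValue_sub' {μ : ℝ} {φ : AttachedPathsVertex n c len → ℝ}
    (hφ : IsWeakEigenvector μ φ) (hμ : μ ≠ 0) {k : ℕ} (hk : k + 1 < n) :
    mainValue φ (k + 1) - mainValue φ k = -(μ * headSum φ (k + 1)) := by
  have h1 := hφ.mainValue_sub hk
  have h2 := headSum_add_tailSum φ (k + 1)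
  rw [hφ.sum_eq_zero hμ] at h2
  rw [h1, eq_neg_of_add_eq_zero_right h2]
  ring

/-- The test function is the indicator of the outer part of the branch. New vertices count from 0,
so `branchValue φ p (j + 1)` belongs to vertex `j`. -/
theorem IsWeakEigenvector.branchValue_sub {μ : ℝ} {φ : AttachedPathsVertex n c len → ℝ}
    (hφ : IsWeakEigenvector μ φ) (p : Σ k : Fin n, Fin (c k)) {j : ℕ} (hj : j < len p.1 p.2) :
    branchValue φ p (j + 1) - branchValue φ p j =
      μ * ∑ i ∈ Finset.range (len p.1 p.2), if j ≤ i then branchValue φ p (i + 1) else 0 := by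
  have h := hφ fun w => match w with
    | Sum.inl _ => 0
    | Sum.inr v => if v.1 = p ∧ j ≤ v.2.val then 1 else 0
  have h2 : ∑ i ∈ Finset.range (len p.1 p.2), (if j ≤ i then branchValue φ p (i + 1) else 0) =
      ∑ i : Fin (len p.1 p.2), if j ≤ i.val then φ (Sum.inr ⟨p, i⟩) else 0 := by
    rw [← Fin.sum_univ_eq_sum_range (fun i => if j ≤ i then branchValue φ p (i + 1) else 0)]
    refine Finset.sum_congr rfl fun i _ => ?_
    rw [branchValue_succ]
  rw [h2]
  conv_rhs at h => rw [Fintype.sum_sum_type, Fintype.sum_sigma, Finset.sum_eq_single p (by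
    intro q _ hq
    simp [hq]) (by simp)]
  simp only [mul_zero, Finset.sum_const_zero, zero_add, true_and, mul_ite, mul_one] at h
  rw [← h, Finset.sum_eq_single (Sum.inr ⟨p, ⟨j, hj⟩⟩)]
  · rw [branchValue_succ φ p ⟨j, hj⟩]
    rcases j with _ | j
    · simp [parent, branchValue]
    · have h3 : branchValue φ p (j + 1) = φ (Sum.inr ⟨p, ⟨j, by omega⟩⟩) :=
        branchValue_succ φ p ⟨j, by omega⟩
      rw [h3]
      simp [parent]
  · rintro (i | ⟨q, i⟩) _ hw
    · simp [parent]
    · by_cases hq : q = p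
      · subst hq
        have h1 : i.val ≠ j := fun h1 => hw (by subst h1; rfl)
        by_cases hi : i.val = 0
        · have : ¬ j ≤ i.val := by omega
          simp [parent, hi]
          omega
        · have : j ≤ i.val ↔ j ≤ i.val - 1 := by omega
          simp [parent, hi, this]
      · by_cases hi : i.val = 0 <;> simp [parent, hi, hq]
  · simp

end AttachedPaths

/-! ### Signs and monotonicity of a Fiedler vector -/

namespace AttachedPaths

variable {n : ℕ} {c : Fin n → ℕ} {len : (k : Fin n) → Fin (c k) → ℕ}

/-- `μ` is positive and small compared with the lengths of the attached paths. -/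
def IsSmallFor (len : (k : Fin n) → Fin (c k) → ℕ) (μ : ℝ) : Prop :=
  0 < μ ∧ ∀ k i, μ * (len k i : ℝ) ^ 2 < 1 / 2

theorem IsWeakEigenvector.abs_sub_lt_or {μ : ℝ} {φ : AttachedPathsVertex n c len → ℝ}
    (hφ : IsWeakEigenvector μ φ) (hμ : IsSmallFor len μ) (w : AttachedPathsVertex n c len) :
    |φ w - mainValue φ (foot w)| < |mainValue φ (foot w)| ∨
      mainValue φ (foot w) = 0 ∧ φ w = 0 := by
  rcases w with k | ⟨p, j⟩
  · rw [foot, mainValue_inl]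
    by_cases h : φ (Sum.inl k) = 0
    · exact Or.inr ⟨h, h⟩
    · left
      simpa using h
  · have h := abs_sub_lt_or_eq_zero hμ.1.le (hμ.2 p.1 p.2) (z := branchValue φ p)
      (fun i hi => hφ.branchValue_sub p hi) (i := j.val + 1) (by omega)
    rw [branchValue_succ] at h
    rw [foot, mainValue_inl]
    exact h

theorem IsWeakEigenvector.pos {μ : ℝ} {φ : AttachedPathsVertex n c len → ℝ}
    (hφ : IsWeakEigenvector μ φ) (hμ : IsSmallFor len μ) {w : AttachedPathsVertex n c len}
    (hw : 0 < mainValue φ (foot w)) : 0 < φ w := by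
  rcases hφ.abs_sub_lt_or hμ w with h | h
  · rw [abs_of_pos hw] at h
    linarith [(abs_lt.mp h).1]
  · exact absurd h.1 hw.ne'

theorem IsWeakEigenvector.neg_of_neg {μ : ℝ} {φ : AttachedPathsVertex n c len → ℝ}
    (hφ : IsWeakEigenvector μ φ) (hμ : IsSmallFor len μ) {w : AttachedPathsVertex n c len}
    (hw : mainValue φ (foot w) < 0) : φ w < 0 := by
  have h := hφ.neg.pos hμ (w := w) (by rw [mainValue_neg]; linarith)
  simpa using h

theorem IsWeakEigenvector.eq_zero {μ : ℝ} {φ : AttachedPathsVertex n c len → ℝ}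
    (hφ : IsWeakEigenvector μ φ) (hμ : IsSmallFor len μ) {w : AttachedPathsVertex n c len}
    (hw : mainValue φ (foot w) = 0) : φ w = 0 := by
  rcases hφ.abs_sub_lt_or hμ w with h | h
  · rw [hw, abs_zero] at h
    exact absurd h (abs_nonneg _).not_gt
  · exact h.2

theorem IsWeakEigenvector.nonpos {μ : ℝ} {φ : AttachedPathsVertex n c len → ℝ}
    (hφ : IsWeakEigenvector μ φ) (hμ : IsSmallFor len μ) {w : AttachedPathsVertex n c len}
    (hw : mainValue φ (foot w) ≤ 0) : φ w ≤ 0 := by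
  rcases hw.eq_or_lt with h | h
  · exact (hφ.eq_zero hμ h).le
  · exact (hφ.neg_of_neg hμ h).le

/-- Unique continuation: if `φ` vanishes on the main path before some vertex, it vanishes on the
branches there too, so no mass drives a change at the next step. -/
theorem IsWeakEigenvector.eq_zero_of_first {μ : ℝ} {φ : AttachedPathsVertex n c len → ℝ}
    (hφ : IsWeakEigenvector μ φ) (hμ : IsSmallFor len μ) (h0 : mainValue φ 0 = 0) : φ = 0 := by
  have h : ∀ k, k < n → mainValue φ k = 0 := by
    intro k
    induction k using Nat.strong_induction_on with
    | _ k ih =>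
      intro hk
      rcases k with _ | k
      · exact h0
      · have h1 := hφ.mainValue_sub' hμ.1.ne' hk
        have h2 : headSum φ (k + 1) = 0 := by
          refine Finset.sum_eq_zero fun w _ => ?_
          split_ifs with hw
          · exact hφ.eq_zero hμ (ih _ hw (by omega))
          · rfl
        rw [h2, ih k (by omega) (by omega)] at h1
        linarith
  funext w
  exact hφ.eq_zero hμ (h _ (foot_lt w))

theorem IsWeakEigenvector.eq_zero_of_last {μ : ℝ} {φ : AttachedPathsVertex n c len → ℝ}
    (hφ : IsWeakEigenvector μ φ) (hμ : IsSmallFor len μ) (h0 : mainValue φ (n - 1) = 0) :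
    φ = 0 := by
  have h : ∀ d, ∀ k, n - 1 - d ≤ k → k < n → mainValue φ k = 0 := by
    intro d
    induction d with
    | zero =>
      intro k hk hkn
      rwa [show k = n - 1 by omega]
    | succ d ih =>
      intro k hk hkn
      by_cases hd : n - 1 - d ≤ k
      · exact ih k hd hkn
      · have h1 := hφ.mainValue_sub (k := k) (by omega)
        have h2 : tailSum φ (k + 1) = 0 := by
          refine Finset.sum_eq_zero fun w _ => ?_
          split_ifs with hw
          · exact hφ.eq_zero hμ (ih _ (by omega) (foot_lt w))
          · rfl
        rw [h2, ih (k + 1) (by omega) (by omega)] at h1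
        linarith
  funext w
  exact hφ.eq_zero hμ (h n _ (by omega) (foot_lt w))

open Matrix in
/-- The energy of a multiple `h φ` of an eigenvector `φ`. -/
theorem IsWeakEigenvector.energy_mul [DecidableRel (attachedPathsGraph n c len).Adj] {μ : ℝ}
    {φ : AttachedPathsVertex n c len → ℝ} (hφ : IsWeakEigenvector μ φ)
    (h : AttachedPathsVertex n c len → ℝ) :
    (h * φ) ⬝ᵥ ((attachedPathsGraph n c len).lapMatrix ℝ *ᵥ (h * φ)) =
      μ * ((h * φ) ⬝ᵥ (h * φ)) + ∑ w, φ w * φ (parent w) * (h w - h (parent w)) ^ 2 := by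
  -- Testing with `h ^ 2 φ` turns the energy of `h φ` into `μ` times its square norm, up to one
  -- correction for each edge across which `h` changes.
  have h1 := hφ (h * h * φ)
  rw [dotProduct_lapMatrix_mulVec]
  have h2 : ∑ w, φ w * (h * h * φ) w = (h * φ) ⬝ᵥ (h * φ) :=
    Finset.sum_congr rfl fun w _ => by simp only [Pi.mul_apply]; ring
  rw [← h2, ← h1, ← Finset.sum_add_distrib]
  exact Finset.sum_congr rfl fun w _ => by simp only [Pi.mul_apply]; ring

theorem headSum_pos {μ : ℝ} {φ : AttachedPathsVertex n c len → ℝ}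
    (hφ : IsWeakEigenvector μ φ) (hμ : IsSmallFor len μ) (hn : 0 < n) (h0 : 0 < mainValue φ 0)
    {k : ℕ} (hk : 0 < k) (h : ∀ i < k, 0 ≤ mainValue φ i) : 0 < headSum φ k := by
  refine Finset.sum_pos' (fun w _ => ?_) ⟨Sum.inl ⟨0, hn⟩, Finset.mem_univ _, ?_⟩
  · split_ifs with hw
    · have := hφ.neg.nonpos hμ (w := w) (by rw [mainValue_neg]; linarith [h _ hw])
      simpa using this
    · exact le_rfl
  · rw [foot, if_pos hk, ← mainValue_inl φ]
    exact h0

/-- The signs of a Fiedler vector along the main path change only once. -/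
theorem exists_sign_change [DecidableRel (attachedPathsGraph n c len).Adj] (hn : 0 < n)
    (hcard : 2 ≤ Fintype.card (AttachedPathsVertex n c len))
    (hμ : IsSmallFor len (lambdaTwo (attachedPathsGraph n c len) hcard))
    {φ : AttachedPathsVertex n c len → ℝ}
    (hφ : IsWeakEigenvector (lambdaTwo (attachedPathsGraph n c len) hcard) φ)
    (h0 : 0 < mainValue φ 0) :
    ∃ a < n, (∀ k < a, 0 < mainValue φ k) ∧ mainValue φ a ≤ 0 ∧
      ∀ k, a < k → k < n → mainValue φ k < 0 := by
  classical
  have hex : ∃ a, a < n ∧ mainValue φ a ≤ 0 := by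
    by_contra! hc
    have h1 := headSum_pos hφ hμ hn h0 hn fun i hi => (hc i hi).le
    have h2 := hφ.sum_eq_zero hμ.1.ne'
    have h3 : headSum φ n = ∑ w, φ w :=
      Finset.sum_congr rfl fun w _ => if_pos (foot_lt w)
    linarith
  set a := Nat.find hex with ha
  obtain ⟨han, ha0⟩ : a < n ∧ mainValue φ a ≤ 0 := Nat.find_spec hex
  have hapos : ∀ k < a, 0 < mainValue φ k := by
    intro k hk
    have := Nat.find_min hex hk
    push Not at this
    exact this (by omega)
  refine ⟨a, han, hapos, ha0, ?_⟩
  -- Otherwise `φ` is nonnegative again at some first `b > a`. A Courant-type argument rescales `φ`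
  -- separately before `a` and from `b` on, and removes the piece between.
  by_contra! hc
  set b := Nat.find hc with hb
  obtain ⟨hab, hbn, hb0⟩ : a < b ∧ b < n ∧ 0 ≤ mainValue φ b := Nat.find_spec hc
  have hbneg : ∀ k, a ≤ k → k < b → mainValue φ k ≤ 0 := by
    intro k hk hkb
    rcases hk.eq_or_lt with rfl | hk
    · exact ha0
    · have := Nat.find_min hc hkb
      push Not at this
      exact (this hk (by omega)).le
  have ha1 : 0 < a := by
    by_contra h
    have : a = 0 := by omega
    rw [this] at ha0
    linarith
  set S := headSum φ a with hS
  set T := tailSum φ b with hT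
  have hSpos : 0 < S := headSum_pos hφ hμ hn h0 ha1 fun i hi => (hapos i hi).le
  -- The weights `-T` and `S` are chosen so that `h * φ` has sum zero.
  set g : ℕ → ℝ := fun k => if k < a then -T else if k < b then 0 else S with hg
  set h : AttachedPathsVertex n c len → ℝ := fun w => g (foot w) with hh
  have hψsum : ∑ w, (h * φ) w = 0 := by
    have : ∑ w, (h * φ) w = -T * S + S * T := by
      rw [hS, hT, headSum, tailSum, Finset.mul_sum, Finset.mul_sum, ← Finset.sum_add_distrib]
      refine Finset.sum_congr rfl fun w _ => ?_
      simp only [Pi.mul_apply, hh, hg]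
      by_cases h1 : foot w < a
      · rw [if_pos h1, if_pos h1, if_neg (by omega : ¬ b ≤ foot w)]
        simp [hT, tailSum]
      · by_cases h2 : foot w < b
        · rw [if_neg h1, if_neg h1, if_pos h2, if_neg (by omega : ¬ b ≤ foot w)]
          simp
        · rw [if_neg h1, if_neg h1, if_neg h2, if_pos (by omega : b ≤ foot w)]
          simp [hS, headSum]
    rw [this]
    ring
  -- `h` changes only across the edges entering `a` and `b`, where the two values of `φ` have a
  -- nonpositive product. Hence `h * φ` attains the minimum and is itself an eigenvector.
  have hterm : ∑ w, φ w * φ (parent w) * (h w - h (parent w)) ^ 2 ≤ 0 := by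
    refine Finset.sum_nonpos fun w _ => ?_
    rcases w with k | ⟨p, j⟩
    · by_cases hk : φ (Sum.inl k) * φ (parent (Sum.inl k)) ≤ 0
      · exact mul_nonpos_of_nonpos_of_nonneg hk (sq_nonneg _)
      · have hpar : φ (parent (Sum.inl k)) = mainValue φ (k.val - 1) :=
          (mainValue_of_lt φ (by omega)).symm
        rw [← mainValue_inl φ k, hpar] at hk
        have hka : k.val ≠ a := by
          intro hka
          rw [hka] at hk
          exact hk (mul_nonpos_of_nonpos_of_nonneg ha0 (hapos _ (by omega)).le)
        have hkb : k.val ≠ b := by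
          intro hkb
          rw [hkb] at hk
          exact hk (mul_nonpos_of_nonneg_of_nonpos hb0 (hbneg _ (by omega) (by omega)))
        have : h (Sum.inl k) = h (parent (Sum.inl k)) := by
          simp only [hh, hg, foot, parent]
          have e1 : k.val < a ↔ k.val - 1 < a := by omega
          have e2 : k.val < b ↔ k.val - 1 < b := by omega
          simp only [e1, e2]
        rw [this]
        simp
    · have : h (Sum.inr ⟨p, j⟩) = h (parent (Sum.inr ⟨p, j⟩)) := by
        by_cases hj : j.val = 0 <;> simp [hh, parent, foot, hj]
      rw [this]
      simp
  have hψ : IsWeakEigenvector (lambdaTwo (attachedPathsGraph n c len) hcard) (h * φ) := by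
    refine IsWeakEigenvector.of_mulVec (lapMatrix_mulVec_eq_of_le _ hcard hψsum ?_)
    rw [hφ.energy_mul]
    linarith
  have hval : ∀ k < n, mainValue (h * φ + T • φ) k = (g k + T) * mainValue φ k := by
    intro k hk
    rw [mainValue_of_lt _ hk, mainValue_of_lt _ hk]
    simp only [Pi.add_apply, Pi.mul_apply, Pi.smul_apply, smul_eq_mul, hh, foot]
    ring
  -- The multiple of `φ` is chosen to cancel the first value, so the sum vanishes identically. At
  -- the last vertex this yields `T = -S ≠ 0`, and then `φ` is zero on the main path from `a` up to
  -- `b`.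
  have hzero : h * φ + T • φ = 0 := by
    refine (hψ.add (hφ.smul T)).eq_zero_of_first hμ ?_
    rw [hval 0 hn]
    simp [hg, ha1]
  have hval0 : ∀ k < n, (g k + T) * mainValue φ k = 0 := by
    intro k hk
    rw [← hval k hk, hzero, mainValue_of_lt _ hk]
    rfl
  have hlast : mainValue φ (n - 1) ≠ 0 := by
    intro hc
    have := hφ.eq_zero_of_last hμ hc
    rw [this, mainValue_of_lt _ hn] at h0
    exact lt_irrefl _ h0
  have hST : S + T = 0 := by
    have h1 := hval0 (n - 1) (by omega)
    have h2 : g (n - 1) = S := by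
      simp only [hg]
      rw [if_neg (by omega), if_neg (by omega)]
    rw [h2] at h1
    exact (mul_eq_zero.mp h1).resolve_right hlast
  have hmid : ∀ k, a ≤ k → k < b → mainValue φ k = 0 := by
    intro k h1 h2
    have h3 := hval0 k (by omega)
    have h4 : g k = 0 := by
      simp only [hg]
      rw [if_neg (by omega), if_pos h2]
    rw [h4] at h3
    refine (mul_eq_zero.mp h3).resolve_left ?_
    linarith
  -- After a zero at `a` the positive mass before it forces a strict drop, against both `a + 1 = b`
  -- and `a + 1 < b`.
  have hnext : mainValue φ (a + 1) < 0 := by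
    have h1 := hφ.mainValue_sub' hμ.1.ne' (k := a) (by omega)
    have h2 := headSum_pos hφ hμ hn h0 (k := a + 1) (by omega) fun i hi => by
      rcases (Nat.lt_succ_iff.mp hi).eq_or_lt with rfl | h
      · exact (hmid _ le_rfl hab).ge
      · exact (hapos i h).le
    rw [hmid a le_rfl hab] at h1
    nlinarith [mul_pos hμ.1 h2]
  rcases (Nat.succ_le_of_lt hab).eq_or_lt with h1 | h1
  · rw [← h1] at hb0
    exact hnext.not_ge hb0
  · exact hnext.ne (hmid (a + 1) (by omega) h1)

/-- A Fiedler vector is monotone along the main path. -/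
theorem mainValue_antitone [DecidableRel (attachedPathsGraph n c len).Adj] (hn : 0 < n)
    (hcard : 2 ≤ Fintype.card (AttachedPathsVertex n c len))
    (hμ : IsSmallFor len (lambdaTwo (attachedPathsGraph n c len) hcard))
    {φ : AttachedPathsVertex n c len → ℝ}
    (hφ : IsWeakEigenvector (lambdaTwo (attachedPathsGraph n c len) hcard) φ)
    (h0 : 0 < mainValue φ 0) {i j : ℕ} (hij : i ≤ j) (hj : j < n) :
    mainValue φ j ≤ mainValue φ i := by
  obtain ⟨a, han, hpos, ha0, hneg⟩ := exists_sign_change hn hcard hμ hφ h0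
  induction j, hij using Nat.le_induction with
  | base => exact le_rfl
  | succ j hij ih =>
    refine le_trans ?_ (ih (by omega))
    -- Before the sign change the mass behind the edge is positive; from there on the mass ahead is
    -- nonpositive. Either way the step goes down.
    by_cases hja : j < a
    · have h1 := hφ.mainValue_sub' hμ.1.ne' hj
      have h2 := headSum_pos hφ hμ hn h0 (k := j + 1) (by omega) fun i hi => (hpos i (by omega)).le
      nlinarith [mul_pos hμ.1 h2]
    · have h1 := hφ.mainValue_sub hj
      have h2 : tailSum φ (j + 1) ≤ 0 := by
        refine Finset.sum_nonpos fun w _ => ?_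
        split_ifs with hw
        · exact (hφ.neg_of_neg hμ (hneg _ (by omega) (foot_lt w))).le
        · exact le_rfl
      nlinarith [mul_nonneg hμ.1.le (neg_nonneg.mpr h2)]

/-! ### Comparing branches with the ends of the main path -/

/-- The sum of `φ` over the vertices whose branch is attached at `k`. -/
noncomputable def footSum (φ : AttachedPathsVertex n c len → ℝ) (k : ℕ) : ℝ :=
  ∑ w, if foot w = k then φ w else 0

theorem tailSum_eq (φ : AttachedPathsVertex n c len → ℝ) (k : ℕ) :
    tailSum φ k = footSum φ k + tailSum φ (k + 1) := by
  rw [tailSum, footSum, tailSum, ← Finset.sum_add_distrib]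
  refine Finset.sum_congr rfl fun w _ => ?_
  rcases lt_trichotomy (foot w) k with h | h | h
  · rw [if_neg (by omega), if_neg (by omega), if_neg (by omega), add_zero]
  · rw [if_pos (by omega), if_pos h, if_neg (by omega), add_zero]
  · rw [if_pos (by omega), if_neg (by omega), if_pos (by omega), zero_add]

/-- Branches add mass of the same sign to their foot. This turns the eigenvalue equation on the main
path into the inequalities required of `u` in `branch_le`. -/
theorem mainValue_le_footSum {μ : ℝ} {φ : AttachedPathsVertex n c len → ℝ}
    (hφ : IsWeakEigenvector μ φ) (hμ : IsSmallFor len μ) {k : ℕ} (hk : k < n)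
    (h : 0 < mainValue φ k) : mainValue φ k ≤ footSum φ k := by
  have h1 := Finset.single_le_sum (f := fun w => if foot w = k then φ w else 0)
    (s := Finset.univ) (fun w _ => by
      split_ifs with hw
      · exact (hφ.pos hμ (by rwa [hw])).le
      · exact le_rfl) (Finset.mem_univ (Sum.inl ⟨k, hk⟩))
  simp only [foot, if_true] at h1
  rwa [mainValue_of_lt φ hk]

theorem IsWeakEigenvector.second_difference {μ : ℝ} {φ : AttachedPathsVertex n c len → ℝ}
    (hφ : IsWeakEigenvector μ φ) {k : ℕ} (hk : k + 2 < n) :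
    mainValue φ (k + 2) - 2 * mainValue φ (k + 1) + mainValue φ k =
      -(μ * footSum φ (k + 1)) := by
  have h1 := hφ.mainValue_sub (k := k) (by omega)
  have h2 := hφ.mainValue_sub hk
  rw [tailSum_eq] at h1
  linarith

/-- An attached path on which `φ` is positive does not exceed the first value of `φ`. -/
theorem IsWeakEigenvector.le_first {μ : ℝ} {φ : AttachedPathsVertex n c len → ℝ}
    (hφ : IsWeakEigenvector μ φ) (hμ : IsSmallFor len μ) {p : Σ k : Fin n, Fin (c k)}
    (hp : len p.1 p.2 ≤ p.1.val) (hpos : ∀ i ≤ p.1.val, 0 < mainValue φ i)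
    (hle : mainValue φ p.1 ≤ mainValue φ (len p.1 p.2)) (j : Fin (len p.1 p.2)) :
    φ (Sum.inr ⟨p, j⟩) ≤ mainValue φ 0 := by
  have hk := p.1.isLt
  rw [← branchValue_succ φ]
  refine branch_le hμ.1.le (m := len p.1 p.2) (fun i hi => hpos i (by omega)) ?_ ?_ ?_
    (fun i hi => hφ.branchValue_sub p hi) ?_ (by omega)
  · rintro (_ | i) hi
    · rw [branchValue, ← mainValue_inl φ]
      exact hpos _ le_rfl
    · have h1 := branchValue_succ φ p ⟨i, hi⟩
      simp only at h1
      rw [h1]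
      exact hφ.pos hμ (hpos _ le_rfl)
  · intro h1
    have h2 := hφ.mainValue_sub (k := 0) (by omega)
    have h3 := tailSum_eq φ 0
    have h4 : tailSum φ 0 = 0 := by
      rw [← hφ.sum_eq_zero hμ.1.ne']
      simp [tailSum]
    have h5 := mainValue_le_footSum hφ hμ (by omega) (hpos 0 (by omega))
    rw [zero_add] at h2 h3
    rw [h2, show tailSum φ 1 = -footSum φ 0 by linarith, mul_neg]
    exact neg_le_neg (mul_le_mul_of_nonneg_left h5 hμ.1.le)
  · intro i hi
    rw [hφ.second_difference (by omega)]
    have h5 := mainValue_le_footSum hφ hμ (k := i + 1) (by omega) (hpos _ (by omega))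
    exact neg_le_neg (mul_le_mul_of_nonneg_left h5 hμ.1.le)
  · rw [branchValue, ← mainValue_inl φ]
    exact hle

/-- An attached path on which `φ` is positive does not exceed the last value of `φ`. -/
theorem IsWeakEigenvector.le_last {μ : ℝ} {φ : AttachedPathsVertex n c len → ℝ}
    (hφ : IsWeakEigenvector μ φ) (hμ : IsSmallFor len μ) {p : Σ k : Fin n, Fin (c k)}
    (hp : len p.1 p.2 + p.1.val + 1 ≤ n) (hpos : ∀ i, p.1.val ≤ i → i < n → 0 < mainValue φ i)
    (hle : mainValue φ p.1 ≤ mainValue φ (n - 1 - len p.1 p.2)) (j : Fin (len p.1 p.2)) :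
    φ (Sum.inr ⟨p, j⟩) ≤ mainValue φ (n - 1) := by
  have hk := p.1.isLt
  rw [← branchValue_succ φ]
  -- The main path is read backwards, so that the comparison piece starts at its last vertex.
  refine branch_le hμ.1.le (m := len p.1 p.2) (u := fun i => mainValue φ (n - 1 - i))
    (fun i hi => hpos _ (by omega) (by omega)) ?_ ?_ ?_
    (fun i hi => hφ.branchValue_sub p hi) ?_ (by omega)
  · rintro (_ | i) hi
    · rw [branchValue, ← mainValue_inl φ]
      exact hpos _ le_rfl hk
    · have h1 := branchValue_succ φ p ⟨i, hi⟩
      simp only at h1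
      rw [h1]
      exact hφ.pos hμ (hpos _ le_rfl hk)
  · intro h1
    have h2 := hφ.mainValue_sub (k := n - 2) (by omega)
    have e : n - 2 + 1 = n - 1 := by omega
    rw [e] at h2
    have h3 := tailSum_eq φ (n - 1)
    have h4 : tailSum φ (n - 1 + 1) = 0 := by
      refine Finset.sum_eq_zero fun w _ => ?_
      have := foot_lt w
      rw [if_neg (by omega)]
    have h5 := mainValue_le_footSum hφ hμ (k := n - 1) (by omega) (hpos _ (by omega) (by omega))
    rw [h3, h4, add_zero] at h2
    simp only [Nat.sub_zero]
    rw [show n - 1 - 1 = n - 2 by omega]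
    nlinarith [mul_le_mul_of_nonneg_left h5 hμ.1.le]
  · intro i hi
    obtain ⟨d, hd⟩ : ∃ d, n - 1 = d + (i + 2) := ⟨n - 1 - (i + 2), by omega⟩
    have h1 := hφ.second_difference (k := d) (by omega)
    have h5 := mainValue_le_footSum hφ hμ (k := d + 1) (by omega) (hpos _ (by omega) (by omega))
    have h6 := mul_le_mul_of_nonneg_left h5 hμ.1.le
    rw [show n - 1 - (i + 2) = d by omega, show n - 1 - (i + 1) = d + 1 by omega,
      show n - 1 - i = d + 2 by omega]
    linarith
  · rw [branchValue, ← mainValue_inl φ]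
    exact hle

/-- A Fiedler vector that is positive at the first vertex of the main path has its extrema at the
ends of the main path. -/
theorem extrema_of_pos [DecidableRel (attachedPathsGraph n c len).Adj] (hn : 0 < n)
    (hcard : 2 ≤ Fintype.card (AttachedPathsVertex n c len))
    (hμ : IsSmallFor len (lambdaTwo (attachedPathsGraph n c len) hcard))
    (hlen : ∀ k i, len k i ≤ k.val ∧ len k i + k.val + 1 ≤ n)
    {φ : AttachedPathsVertex n c len → ℝ}
    (hφ : IsWeakEigenvector (lambdaTwo (attachedPathsGraph n c len) hcard) φ)
    (h0 : 0 < mainValue φ 0) (w : AttachedPathsVertex n c len) :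
    φ w ≤ mainValue φ 0 ∧ mainValue φ (n - 1) ≤ φ w := by
  have hanti : ∀ {i j : ℕ}, i ≤ j → j < n → mainValue φ j ≤ mainValue φ i := fun hij hj =>
    mainValue_antitone hn hcard hμ hφ h0 hij hj
  have hfoot := foot_lt w
  rcases w with k | ⟨p, j⟩
  · rw [← mainValue_inl φ]
    exact ⟨hanti (Nat.zero_le _) k.isLt, hanti (by omega) (by omega)⟩
  have hk := p.1.isLt
  obtain ⟨hl1, hl2⟩ := hlen p.1 p.2
  constructor
  · rcases le_or_gt (mainValue φ p.1) 0 with h | h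
    · exact (hφ.nonpos hμ (w := Sum.inr ⟨p, j⟩) h).trans h0.le
    · exact hφ.le_first hμ hl1 (fun i hi => h.trans_le (hanti hi hk)) (hanti hl1 hk) j
  · have hneg : mainValue φ (n - 1) ≤ mainValue φ p.1 := hanti (by omega) (by omega)
    rcases le_or_gt 0 (mainValue φ p.1) with h | h
    · have h1 := hφ.neg.nonpos hμ (w := Sum.inr ⟨p, j⟩) (by
        rw [mainValue_neg]
        simpa [foot] using h)
      -- The branch is nonnegative here, while the last main value is at most the nonpositive one at
      -- the sign change.
      obtain ⟨a, han, hpos, ha0, -⟩ := exists_sign_change hn hcard hμ hφ h0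
      have h2 : mainValue φ (n - 1) ≤ mainValue φ a := hanti (by omega) (by omega)
      simp only [Pi.neg_apply] at h1
      linarith
    · have h1 := hφ.neg.le_last hμ hl2 (fun i hi hin => by
        rw [mainValue_neg]
        linarith [hanti hi hin]) (by
        rw [mainValue_neg, mainValue_neg]
        exact neg_le_neg (hanti (by omega) (by omega))) j
      rw [mainValue_neg] at h1
      simpa using h1

/-! ### The size of `λ₂` -/

/-- The centre `x` will be the mean over the whole tree, not over the main path; completing the
square makes the bound independent of it. -/
theorem sum_range_sub_sq (n : ℕ) (x : ℝ) :
    ∑ k ∈ Finset.range n, ((k : ℝ) - x) ^ 2 =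
      n * (x - (n - 1) / 2) ^ 2 + n * ((n : ℝ) ^ 2 - 1) / 12 := by
  induction n with
  | zero => simp
  | succ n ih =>
    rw [Finset.sum_range_succ, ih]
    push_cast
    ring

/-- The test function is `foot`, centred. It is constant on branches, so its energy is at most `n`,
while the main path alone gives square norm at least `n * (n ^ 2 - 1) / 12`. -/
theorem lambdaTwo_mul_sq_sub_one_le [DecidableRel (attachedPathsGraph n c len).Adj] (hn : 0 < n)
    (hcard : 2 ≤ Fintype.card (AttachedPathsVertex n c len)) :
    lambdaTwo (attachedPathsGraph n c len) hcard * ((n : ℝ) ^ 2 - 1) ≤ 12 := by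
  set μ := lambdaTwo (attachedPathsGraph n c len) hcard with hμdef
  have hμ : 0 ≤ μ := lambdaTwo_nonneg _ _
  set N : ℝ := ((Fintype.card (AttachedPathsVertex n c len) : ℕ) : ℝ) with hN
  have hN0 : N ≠ 0 := by
    rw [hN]
    exact_mod_cast (by omega : Fintype.card (AttachedPathsVertex n c len) ≠ 0)
  set x : ℝ := (∑ w : AttachedPathsVertex n c len, (foot w : ℝ)) / N with hx
  have hsum : ∑ w : AttachedPathsVertex n c len, ((foot w : ℝ) - x) = 0 := by
    rw [Finset.sum_sub_distrib, Finset.sum_const, Finset.card_univ, nsmul_eq_mul, ← hN, hx,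
      mul_div_cancel₀ _ hN0, sub_self]
  have h1 := lambdaTwo_mul_le (attachedPathsGraph n c len) hcard hsum
  rw [dotProduct_lapMatrix_mulVec] at h1
  have h2 : ∑ w : AttachedPathsVertex n c len, ((foot w : ℝ) - x - ((foot (parent w) : ℝ) - x)) *
      ((foot w : ℝ) - x - ((foot (parent w) : ℝ) - x)) ≤ n := by
    rw [Fintype.sum_sum_type]
    have h3 : ∑ v : (Σ p : (Σ k : Fin n, Fin (c k)), Fin (len p.1 p.2)),
        ((foot (Sum.inr v : AttachedPathsVertex n c len) : ℝ) - x -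
          ((foot (parent (Sum.inr v : AttachedPathsVertex n c len)) : ℝ) - x)) *
        ((foot (Sum.inr v : AttachedPathsVertex n c len) : ℝ) - x -
          ((foot (parent (Sum.inr v : AttachedPathsVertex n c len)) : ℝ) - x)) = 0 := by
      refine Finset.sum_eq_zero fun v _ => ?_
      obtain ⟨p, j⟩ := v
      by_cases hj : j.val = 0 <;> simp [foot, parent, hj]
    rw [h3, add_zero]
    have h4 : ∑ k : Fin n, ((foot (Sum.inl k : AttachedPathsVertex n c len) : ℝ) - x -
          ((foot (parent (Sum.inl k : AttachedPathsVertex n c len)) : ℝ) - x)) *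
        ((foot (Sum.inl k : AttachedPathsVertex n c len) : ℝ) - x -
          ((foot (parent (Sum.inl k : AttachedPathsVertex n c len)) : ℝ) - x)) ≤
        ∑ k : Fin n, (1 : ℝ) := by
      refine Finset.sum_le_sum fun k _ => ?_
      obtain ⟨h5, h6⟩ := foot_parent_le (Sum.inl k : AttachedPathsVertex n c len)
      have h7 : (foot (parent (Sum.inl k : AttachedPathsVertex n c len)) : ℝ) ≤
        foot (Sum.inl k : AttachedPathsVertex n c len) := by exact_mod_cast h5
      have h8 : (foot (Sum.inl k : AttachedPathsVertex n c len) : ℝ) ≤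
        foot (parent (Sum.inl k : AttachedPathsVertex n c len)) + 1 := by exact_mod_cast h6
      nlinarith
    simpa using h4
  have h3 : (n : ℝ) * ((n : ℝ) ^ 2 - 1) / 12 ≤
      dotProduct (fun w : AttachedPathsVertex n c len => (foot w : ℝ) - x)
        (fun w => (foot w : ℝ) - x) := by
    rw [dotProduct, Fintype.sum_sum_type]
    have h4 : 0 ≤ ∑ v : (Σ p : (Σ k : Fin n, Fin (c k)), Fin (len p.1 p.2)),
        ((foot (Sum.inr v : AttachedPathsVertex n c len) : ℝ) - x) *
        ((foot (Sum.inr v : AttachedPathsVertex n c len) : ℝ) - x) :=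
      Finset.sum_nonneg fun v _ => mul_self_nonneg _
    have h5 : ∑ k : Fin n, ((foot (Sum.inl k : AttachedPathsVertex n c len) : ℝ) - x) *
        ((foot (Sum.inl k : AttachedPathsVertex n c len) : ℝ) - x) =
        ∑ k ∈ Finset.range n, ((k : ℝ) - x) ^ 2 := by
      rw [← Fin.sum_univ_eq_sum_range (fun k : ℕ => ((k : ℝ) - x) ^ 2)]
      exact Finset.sum_congr rfl fun k _ => by rw [foot, sq]
    rw [h5, sum_range_sub_sq]
    have h6 : 0 ≤ (n : ℝ) * (x - (n - 1) / 2) ^ 2 := by positivity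
    linarith
  have hnR : (0 : ℝ) < n := by exact_mod_cast hn
  have h4 := (mul_le_mul_of_nonneg_left h3 hμ).trans (h1.trans h2)
  refine le_of_mul_le_mul_left ?_ hnR
  linarith

end AttachedPaths

/-! ### Assembling the theorem -/

/-- The vertex `k : Fin n` of the main path is the one with number `k + 1` in `1, …, n`. -/
theorem corollary2 (n : ℕ) (hn : 2 ≤ n) (c : Fin n → ℕ) (len : (k : Fin n) → Fin (c k) → ℕ)
    (f : Fin n → ℝ)
    (hf : ∀ k : Fin n, f k ≤ 1 / 20 * min ((k.val : ℝ) + 1) ((n : ℝ) - ((k.val : ℝ) + 1)))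
    (hlen : ∀ (k : Fin n) (i : Fin (c k)), (len k i : ℝ) ≤ f k)
    [DecidableRel (attachedPathsGraph n c len).Adj] :
    (∃ p : (attachedPathsGraph n c len).Walk
        (Sum.inl ⟨0, by omega⟩) (Sum.inl ⟨n - 1, by omega⟩), IsLongestPath p) ∧
    ∀ (u v : AttachedPathsVertex n c len) (p : (attachedPathsGraph n c len).Walk u v),
      IsLongestPath p →
      ∀ φ : AttachedPathsVertex n c len → ℝ, IsFiedlerVector (attachedPathsGraph n c len) φ →
        ((∀ w, φ w ≤ φ u) ∧ (∀ w, φ v ≤ φ w)) ∨ ((∀ w, φ w ≤ φ v) ∧ (∀ w, φ u ≤ φ w)) := by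
  open AttachedPaths in
  have hn0 : 0 < n := by omega
  have hshort : ∀ k i, 20 * len k i ≤ k.val + 1 ∧ 20 * len k i + k.val + 1 ≤ n := by
    intro k i
    have h1 := (hlen k i).trans (hf k)
    have h2 := min_le_left ((k.val : ℝ) + 1) ((n : ℝ) - ((k.val : ℝ) + 1))
    have h3 := min_le_right ((k.val : ℝ) + 1) ((n : ℝ) - ((k.val : ℝ) + 1))
    constructor
    · have : (20 : ℝ) * len k i ≤ k.val + 1 := by linarith
      exact_mod_cast this
    · have : (20 : ℝ) * len k i + k.val + 1 ≤ n := by linarith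
      exact_mod_cast this
  have hlong := isLongestPath_iff (c := c) (len := len) hn0 (by
    rintro (k | ⟨p, j⟩) hw
    · simp [depth] at hw
    · have h1 := hshort p.1 p.2
      have h2 := j.isLt
      simp only [depth, foot]
      omega)
  refine ⟨hlong.1, fun u v p hp φ hφ => ?_⟩
  obtain ⟨hne, hcard, hL⟩ := hφ
  have hw := IsWeakEigenvector.of_mulVec hL
  have hends : ((∀ w, φ w ≤ φ (Sum.inl ⟨0, hn0⟩)) ∧ ∀ w, φ (Sum.inl ⟨n - 1, by omega⟩) ≤ φ w) ∨
      ((∀ w, φ w ≤ φ (Sum.inl ⟨n - 1, by omega⟩)) ∧ ∀ w, φ (Sum.inl ⟨0, hn0⟩) ≤ φ w) := by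
    -- Positivity of `λ₂` need not be proved: if it were zero, `φ` would be constant and the claim
    -- trivial.
    rcases (lambdaTwo_nonneg (attachedPathsGraph n c len) hcard).eq_or_lt with h0 | hpos
    · rw [← h0] at hw
      exact Or.inl ⟨fun w => (hw.eq_of_zero _ _).le, fun w => (hw.eq_of_zero _ _).le⟩
    · have hsmall : IsSmallFor len (lambdaTwo (attachedPathsGraph n c len) hcard) := by
        refine ⟨hpos, fun k i => ?_⟩
        have h1 := lambdaTwo_mul_sq_sub_one_le hn0 hcard
        -- Adding the two bounds in `hshort` gives 40. Since `n ^ 2 - 1 ≥ n ^ 2 / 2`, this leads to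
        -- `λ₂ * len ^ 2 ≤ 12 / 800`, well below `1 / 2`.
        have h2 : 40 * (len k i : ℝ) ≤ n := by
          have h := hshort k i
          exact_mod_cast (by omega : 40 * len k i ≤ n)
        have h3 : (2 : ℝ) ≤ n := by exact_mod_cast hn
        have h4 : (40 * (len k i : ℝ)) ^ 2 ≤ (n : ℝ) ^ 2 :=
          pow_le_pow_left₀ (by positivity) h2 2
        have h5 : 800 * (len k i : ℝ) ^ 2 ≤ (n : ℝ) ^ 2 - 1 := by nlinarith
        have h6 := mul_le_mul_of_nonneg_left h5 hpos.le
        linarith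
      have hlen' : ∀ k i, len k i ≤ k.val ∧ len k i + k.val + 1 ≤ n := by
        intro k i
        have := hshort k i
        omega
      have e0 := mainValue_of_lt φ hn0
      have e1 := mainValue_of_lt φ (by omega : n - 1 < n)
      rw [← e0, ← e1]
      -- The middle case is excluded by unique continuation, and the negative one reduces to `-φ`.
      rcases lt_trichotomy (mainValue φ 0) 0 with h | h | h
      · have h1 := extrema_of_pos hn0 hcard hsmall hlen' hw.neg (by
          rw [mainValue_neg]
          linarith)
        simp only [mainValue_neg, Pi.neg_apply, neg_le_neg_iff] at h1
        exact Or.inr ⟨fun w => (h1 w).2, fun w => (h1 w).1⟩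
      · exact absurd (hw.eq_zero_of_first hsmall h) hne
      · have h1 := extrema_of_pos hn0 hcard hsmall hlen' hw h
        exact Or.inl ⟨fun w => (h1 w).1, fun w => (h1 w).2⟩
  rcases hlong.2 u v p hp with ⟨rfl, rfl⟩ | ⟨rfl, rfl⟩
  · exact hends
  · exact hends.symm
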